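/- Let $n \ge 1$. By a unit regular simplex in $\mathbb{R}^n$ we mean the convex hull $\Delta$ of $n+1$ affinely independent points of $\mathbb{R}^n$ any two of which are at Euclidean distance $1$. Let $B_n$ be the closed Euclidean unit ball of $\mathbb{R}^n$ centred at the origin, and for $0 \le \epsilon \le 1$ let $$K^\epsilon = \epsilon \Delta + \frac{1-\epsilon}{n\sqrt{2}}\, B_n = \left\{ \epsilon x + \tfrac{1-\epsilon}{n\sqrt2}\, y \;:\; x \in \Delta,\ y \in B_n \right\}.$$ For a unit vector $u$ and a set $K \subseteq \mathbb{R}^n$, let $K_u$ denote the orthogonal projection of $K$ onto the hyperplane $u^\perp$, and let $V_n$ denote $n$-dimensional volume (Lebesgue measure). Then: (1) For every unit regular simplex $\Delta$ in $\mathbb{R}^n$, every $\epsilon \in [0,1]$ and every unit vector $u \in \mathbb{R}^n$ there exists $v \in u^\perp$ such that $K^\epsilon_u + v \subseteq \Delta_u$. (2) There exists $\epsilon_0 \in [0,1)$, depending only on $n$, such that $V_n(K^\epsilon) > V_n(\Delta)$ for every $\epsilon$ with $\epsilon_0 < \epsilon < 1$ and every unit regular simplex $\Delta$ in $\mathbb{R}^n$.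 -/

import Mathlib

open scoped Pointwise

noncomputable section

namespace CoveringShadows

/-- `Δ` is a regular simplex of full dimension in `ℝⁿ` with unit edge length: the convex hull of
`n + 1` affinely independent points at mutual distance `1`. -/
def IsUnitRegularSimplex {n : ℕ} (Δ : Set (EuclideanSpace ℝ (Fin n))) : Prop :=
  ∃ s : Affine.Simplex ℝ (EuclideanSpace ℝ (Fin n)) n,
    (∀ i j, i ≠ j → dist (s.points i) (s.points j) = 1) ∧
      Δ = convexHull ℝ (Set.range s.points)

/-- The shadow `K_u`: the orthogonal projection of `K` onto the hyperplane `u^⊥`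
(as a subset of `ℝⁿ`). -/
def shadow {n : ℕ} (K : Set (EuclideanSpace ℝ (Fin n))) (u : EuclideanSpace ℝ (Fin n)) :
    Set (EuclideanSpace ℝ (Fin n)) :=
  (Submodule.span ℝ {u})ᗮ.starProjection '' K

/-- The Minkowski combination `K^ε = ε Δ + ((1 - ε) / (n √2)) B_n`, where `B_n` is the closed
Euclidean unit ball centred at the origin. -/
def kEps {n : ℕ} (Δ : Set (EuclideanSpace ℝ (Fin n))) (ε : ℝ) :
    Set (EuclideanSpace ℝ (Fin n)) :=
  ε • Δ + ((1 - ε) / ((n : ℝ) * Real.sqrt 2)) •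
    Metric.closedBall (0 : EuclideanSpace ℝ (Fin n)) 1

end CoveringShadows

end

/-! The inradius of Δ is r = 1/√(2n(n+1)), while the ball in K^ε has radius 1/(n√2) = κr before
scaling by 1 - ε, with κ = √((n+1)/n) > 1. This ball is too large for Δ, yet each of its shadows
fits in the shadow of Δ after a translation.

Shadows: the barycentric coordinates are affine with gradients 2 q_i, so a line parallel to u meets
Δ as soon as each lower bound on its parameter is at most each upper bound
(`exists_forall_add_mul_nonneg`). By Cauchy–Schwarz this reduces to `shadow_margin`, for a centre
adapted to u. Convexity of Δ then gives every ε.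

Volume: all facets are at distance r from the centroid, so r times the surface area is nV, and
V_n(K^ε) should have derivative n(1 - κ)V < 0 at ε = 1. Instead of mixed volumes,
`two_sub_mul_measure_le_measure_add_ball` gives the lower bound (2ε^n - (ε - κ(1-ε))^n) V, which has
the same value and derivative at ε = 1. -/

open scoped InnerProductSpace

namespace CoveringShadows

/-! ### Metric and barycentric description of the regular simplex -/

variable {E : Type*} [NormedAddCommGroup E] [InnerProductSpace ℝ E]

/-- The Gram matrix of the vectors from the centroid to the vertices of a unit regular simplex. -/
theorem inner_eq_of_dist_eq_one {n : ℕ} (q : Fin (n + 1) → E) (hsum : ∑ i, q i = 0)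
    (hdist : ∀ i j, i ≠ j → ‖q i - q j‖ = 1) (i j : Fin (n + 1)) :
    ⟪q i, q j⟫_ℝ = (if i = j then 1 / 2 else 0) - 1 / (2 * ((n : ℝ) + 1)) := by
  have hn : (0 : ℝ) < (n : ℝ) + 1 := by positivity
  -- Polarization of the unit distances. As the `q i` sum to zero, summing over `j` and then over
  -- `i` determines the norms.
  have key : ∀ i j, ⟪q i, q i⟫_ℝ + ⟪q j, q j⟫_ℝ - 2 * ⟪q i, q j⟫_ℝ
      = 1 - (if i = j then 1 else 0) := by
    intro i j
    split_ifs with h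
    · subst h; ring
    · have h1 := real_inner_self_eq_norm_sq (q i - q j)
      rw [hdist i j h, inner_sub_left, inner_sub_right, inner_sub_right,
        real_inner_comm (q i) (q j)] at h1
      linarith
  have hzero : ∀ i, ∑ j, ⟪q i, q j⟫_ℝ = 0 := fun i => by rw [← inner_sum, hsum, inner_zero_right]
  have hrow : ∀ i, ((n : ℝ) + 1) * ⟪q i, q i⟫_ℝ + ∑ j, ⟪q j, q j⟫_ℝ = n := by
    intro i
    have h := Finset.sum_congr (rfl : Finset.univ = Finset.univ) fun j _ => key i j
    simp only [Finset.sum_sub_distrib, Finset.sum_add_distrib, ← Finset.mul_sum, hzero,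
      Finset.sum_const, Finset.card_univ, Fintype.card_fin,
      Finset.sum_ite_eq, Finset.mem_univ, if_true, nsmul_eq_mul] at h
    push_cast at h
    linarith
  have hS : 2 * ∑ j, ⟪q j, q j⟫_ℝ = (n : ℝ) := by
    have h := Finset.sum_congr (rfl : Finset.univ = Finset.univ) fun j _ => hrow j
    simp only [Finset.sum_add_distrib, ← Finset.mul_sum, Finset.sum_const, Finset.card_univ,
      Fintype.card_fin, nsmul_eq_mul] at h
    push_cast at h
    exact mul_left_cancel₀ hn.ne' (by linarith)
  have hN : ∀ i, ⟪q i, q i⟫_ℝ = 1 / 2 - 1 / (2 * ((n : ℝ) + 1)) := by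
    intro i
    have h := hrow i
    field_simp
    linarith
  have h := key i j
  rw [hN, hN] at h
  split_ifs at h ⊢ <;> linarith

/-- A unit regular simplex, described by the vectors `q i` from its centroid `c` to its
vertices. -/
structure RegularFrame {n : ℕ} (Δ : Set (EuclideanSpace ℝ (Fin n)))
    (c : EuclideanSpace ℝ (Fin n)) (q : Fin (n + 1) → EuclideanSpace ℝ (Fin n)) : Prop where
  sum_eq_zero : ∑ i, q i = 0
  inner_eq : ∀ i j, ⟪q i, q j⟫_ℝ = (if i = j then 1 / 2 else 0) - 1 / (2 * ((n : ℝ) + 1))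
  eq_zero_of_inner : ∀ u, (∀ i, ⟪q i, u⟫_ℝ = 0) → u = 0
  mem_iff : ∀ x, x ∈ Δ ↔ ∀ i, 0 ≤ 1 / ((n : ℝ) + 1) + 2 * ⟪q i, x - c⟫_ℝ

/-- The affine basis of the vertices of a simplex of full dimension. -/
def simplexBasis {n : ℕ} (s : Affine.Simplex ℝ (EuclideanSpace ℝ (Fin n)) n) :
    AffineBasis (Fin (n + 1)) ℝ (EuclideanSpace ℝ (Fin n)) where
  toFun := s.points
  ind' := s.independent
  tot' := s.independent.affineSpan_eq_top_iff_card_eq_finrank_add_one.mpr (by simp)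

theorem IsUnitRegularSimplex.exists_frame {n : ℕ} {Δ : Set (EuclideanSpace ℝ (Fin n))}
    (h : IsUnitRegularSimplex Δ) : ∃ c q, RegularFrame Δ c q := by
  obtain ⟨s, hs, rfl⟩ := h
  set b := simplexBasis s with hb
  have hbp : ∀ i, b i = s.points i := fun i => rfl
  set c : EuclideanSpace ℝ (Fin n) := ((n : ℝ) + 1)⁻¹ • ∑ i, b i with hc
  have hn : (n : ℝ) + 1 ≠ 0 := by positivity
  have hsum : ∑ i, (b i - c) = 0 := by
    rw [Finset.sum_sub_distrib, Finset.sum_const, Finset.card_univ, Fintype.card_fin,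
      ← Nat.cast_smul_eq_nsmul ℝ, hc, smul_smul]
    push_cast
    rw [mul_inv_cancel₀ hn, one_smul, sub_self]
  have hG := inner_eq_of_dist_eq_one (fun i => b i - c) hsum fun i j hij => by
    rw [sub_sub_sub_cancel_right, ← dist_eq_norm, hbp, hbp, hs i j hij]
  -- The Gram matrix is half the identity minus a constant matrix, and the coordinates of `x` sum to
  -- one, so pairing with `b i - c` isolates coordinate `i`.
  have hcoord : ∀ x i, b.coord i x = 1 / ((n : ℝ) + 1) + 2 * ⟪b i - c, x - c⟫_ℝ := by
    intro x i
    have h1 : x - c = ∑ j, b.coord j x • (b j - c) := by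
      simp only [smul_sub, Finset.sum_sub_distrib, ← Finset.sum_smul,
        b.sum_coord_apply_eq_one, one_smul]
      rw [b.linear_combination_coord_eq_self]
    rw [h1, inner_sum]
    simp only [inner_smul_right, hG, mul_sub, Finset.sum_sub_distrib, mul_ite, mul_zero,
      Finset.sum_ite_eq, Finset.mem_univ, if_true, ← Finset.sum_mul, b.sum_coord_apply_eq_one]
    field_simp
    ring
  refine ⟨c, fun i => b i - c, hsum, hG, fun u hu => ?_, fun x => ?_⟩
  · have h1 : c + u = c := by
      rw [← b.linear_combination_coord_eq_self (c + u), ← b.linear_combination_coord_eq_self c]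
      refine Finset.sum_congr rfl fun i _ => ?_
      rw [hcoord, hcoord, b.linear_combination_coord_eq_self]
      simp [hu i]
    simpa using h1
  · have h1 : convexHull ℝ (Set.range s.points) = {x | ∀ i, 0 ≤ b.coord i x} :=
      b.convexHull_eq_nonneg_coord
    simp only [h1, Set.mem_ofPred_eq, hcoord]

theorem IsUnitRegularSimplex.isCompact {n : ℕ} {Δ : Set (EuclideanSpace ℝ (Fin n))}
    (h : IsUnitRegularSimplex Δ) : IsCompact Δ := by
  obtain ⟨s, -, rfl⟩ := h
  exact (Set.finite_range _).isCompact_convexHull ℝ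

theorem IsUnitRegularSimplex.convex {n : ℕ} {Δ : Set (EuclideanSpace ℝ (Fin n))}
    (h : IsUnitRegularSimplex Δ) : Convex ℝ Δ := by
  obtain ⟨s, -, rfl⟩ := h
  exact convex_convexHull ℝ _

theorem IsUnitRegularSimplex.volume_pos {n : ℕ} {Δ : Set (EuclideanSpace ℝ (Fin n))}
    (h : IsUnitRegularSimplex Δ) : 0 < MeasureTheory.volume Δ := by
  obtain ⟨s, -, rfl⟩ := h
  exact MeasureTheory.Measure.measure_pos_of_nonempty_interior _
    ((interior_convexHull_nonempty_iff_affineSpan_eq_top).mpr (simplexBasis s).tot)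

/-! ### Shadows -/

/-- A line meets an intersection of half-spaces as soon as the pairwise conditions hold. -/
theorem exists_forall_add_mul_nonneg {ι : Type*} [Finite ι] (p w : ι → ℝ)
    (hpos : ∃ i, 0 < w i) (h0 : ∀ i, w i = 0 → 0 ≤ p i)
    (h : ∀ i j, 0 < w i → w j < 0 → 0 ≤ p i * -w j + p j * w i) :
    ∃ t : ℝ, ∀ i, 0 ≤ p i + t * w i := by
  -- The witness is the largest lower bound `-p i / w i`; by `h`, no upper bound from a negative
  -- slope lies below it.
  obtain ⟨i, hi, hmax⟩ := Set.exists_max_image {i | 0 < w i} (fun i => -p i / w i)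
    (Set.toFinite _) hpos
  have hi : 0 < w i := hi
  refine ⟨-p i / w i, fun j => ?_⟩
  rcases lt_trichotomy (w j) 0 with hj | hj | hj
  · have := h i j hi hj
    have e : p j + -p i / w i * w j = (p i * -w j + p j * w i) / w i := by field_simp; ring
    rw [e]; positivity
  · rw [hj, mul_zero, add_zero]; exact h0 j hj
  · have := hmax j hj
    rw [div_le_iff₀ hj] at this
    linarith

theorem two_mul_abs_le_sum_abs {ι : Type*} [Fintype ι] (x : ι → ℝ)
    (hx : ∑ i, x i = 0) (i : ι) : 2 * |x i| ≤ ∑ j, |x j| := by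
  classical
  rw [← Finset.add_sum_erase _ _ (Finset.mem_univ i)] at hx ⊢
  have h1 : |x i| = |∑ j ∈ Finset.univ.erase i, x j| := by
    rw [eq_neg_of_add_eq_zero_left hx, abs_neg]
  have := Finset.abs_sum_le_sum_abs x (Finset.univ.erase i)
  linarith

/-- With k = 1/(2(n+1)), right minus left is k²(a²+b²) + a²b²/4 + 2ab(k+k²) + (1-k)ab(2-a-b), a sum
of nonnegative terms. The left side is 2‖b q_i + a q_j‖² for i ≠ j. -/
theorem shadow_margin {n a b : ℝ} (hn : 1 ≤ n) (ha : 0 ≤ a) (ha' : a ≤ 1) (hb : 0 ≤ b)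
    (hb' : b ≤ 1) :
    n / (n + 1) * (a ^ 2 + b ^ 2) - 2 * (a * b) / (n + 1) ≤
      ((2 * n + 1) / (2 * n + 2) * (a + b) - a * b / 2) ^ 2 := by
  have hn1 : 0 < n + 1 := by linarith
  have hA : (2 * n + 1) / (2 * n + 2) = 1 - 1 / (2 * (n + 1)) := by field_simp; ring
  have hB : n / (n + 1) = 1 - 2 * (1 / (2 * (n + 1))) := by field_simp; ring
  have hC : 2 * (a * b) / (n + 1) = 4 * (a * b) * (1 / (2 * (n + 1))) := by field_simp; ring
  rw [hA, hB, hC]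
  have hk : 0 < 1 / (2 * (n + 1)) := by positivity
  have hk' : 1 / (2 * (n + 1)) ≤ 1 := by rw [div_le_one (by positivity)]; linarith
  generalize 1 / (2 * (n + 1)) = k at hk hk'
  have hab : 0 ≤ a * b := mul_nonneg ha hb
  have h1 : 0 ≤ (1 - k) * (a * b) * (2 - (a + b)) :=
    mul_nonneg (mul_nonneg (by linarith) hab) (by linarith)
  nlinarith [sq_nonneg (a * b), mul_nonneg (sq_nonneg k) (add_nonneg (sq_nonneg a) (sq_nonneg b)),
    mul_nonneg hk.le hab, mul_nonneg (sq_nonneg k) hab]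

/-- Every shadow of a unit regular simplex contains a translate of the shadow of the ball of
radius `1 / (n √2)`. -/
theorem RegularFrame.exists_center {n : ℕ} (hn : 1 ≤ n) {Δ : Set (EuclideanSpace ℝ (Fin n))}
    {c : EuclideanSpace ℝ (Fin n)} {q : Fin (n + 1) → EuclideanSpace ℝ (Fin n)}
    (F : RegularFrame Δ c q) {u : EuclideanSpace ℝ (Fin n)} (hu : u ≠ 0) :
    ∃ z, ∀ y : EuclideanSpace ℝ (Fin n), ‖y‖ ≤ 1 / (n * √2) → ∃ t : ℝ, z + y + t • u ∈ Δ := by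
  have hn' : (1 : ℝ) ≤ n := by exact_mod_cast hn
  set m := ∑ i, |⟪q i, u⟫_ℝ| with hm
  have hsum : ∑ i, ⟪q i, u⟫_ℝ = 0 := by rw [← sum_inner, F.sum_eq_zero, inner_zero_left]
  have hne : ∃ i, ⟪q i, u⟫_ℝ ≠ 0 := by
    by_contra! h
    exact hu (F.eq_zero_of_inner u h)
  have hmpos : 0 < m := by
    obtain ⟨i, hi⟩ := hne
    exact Finset.sum_pos' (fun _ _ => abs_nonneg _) ⟨i, Finset.mem_univ _, abs_pos.mpr hi⟩
  have hpos : ∃ i, 0 < ⟪q i, u⟫_ℝ := by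
    obtain ⟨i, -, hi⟩ := Finset.exists_pos_of_sum_zero_of_exists_nonzero _ hsum
      (hne.imp fun i hi => ⟨Finset.mem_univ i, hi⟩)
    exact ⟨i, hi⟩
  set a : Fin (n + 1) → ℝ := fun i => 2 * |⟪q i, u⟫_ℝ| / m with ha
  have ha0 : ∀ i, 0 ≤ a i := fun i => by positivity
  have ha1 : ∀ i, a i ≤ 1 := fun i => by
    rw [div_le_one hmpos]; exact two_mul_abs_le_sum_abs _ hsum i
  have hasum : ∑ i, a i = 2 := by
    rw [ha, ← Finset.sum_div, ← Finset.mul_sum, ← hm]; field_simp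
  -- Barycentric coordinates of the centre, lowered at vertices far from the hyperplane through the
  -- centroid orthogonal to `u`. As the `a i` sum to 2, the constant (2n+1)/(2n+2) makes them sum to
  -- one.
  set γ : Fin (n + 1) → ℝ := fun i => ((2 * n + 1) / (2 * n + 2) - a i / 4) / n with hγ
  have hγsum : ∑ i, γ i = 1 := by
    rw [hγ, ← Finset.sum_div, Finset.sum_sub_distrib, ← Finset.sum_div _ a, hasum]
    simp only [Finset.sum_const, Finset.card_univ, Fintype.card_fin, nsmul_eq_mul]
    push_cast
    field_simp
    ring
  have hz : ∀ i, 1 / ((n : ℝ) + 1) + 2 * ⟪q i, ∑ j, γ j • q j⟫_ℝ = γ i := by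
    intro i
    simp only [inner_sum, inner_smul_right, F.inner_eq, mul_sub, Finset.sum_sub_distrib, mul_ite,
      mul_zero, Finset.sum_ite_eq, Finset.mem_univ, if_true, ← Finset.sum_mul, hγsum]
    field_simp
    ring
  have hcs : ∀ (v y : EuclideanSpace ℝ (Fin n)) (g : ℝ), 0 ≤ g → ‖y‖ ≤ 1 / (n * √2) →
      2 * ⟪v, v⟫_ℝ ≤ (n * g) ^ 2 → 0 ≤ g + 2 * ⟪v, y⟫_ℝ := by
    intro v y g hg hy hv
    have h2 : √2 ^ 2 = (2 : ℝ) := Real.sq_sqrt (by norm_num)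
    have h3 : √2 * ‖v‖ ≤ n * g := by
      refine abs_le_of_sq_le_sq' ?_ (by positivity) |>.2
      rw [mul_pow, h2, ← real_inner_self_eq_norm_sq]; exact hv
    have h4 : 2 * (‖v‖ * ‖y‖) ≤ g := by
      calc 2 * (‖v‖ * ‖y‖) ≤ 2 * (‖v‖ * (1 / (n * √2))) := by gcongr
        _ = √2 * ‖v‖ / n := by field_simp; rw [h2, mul_comm]
        _ ≤ g := by rw [div_le_iff₀ (by positivity)]; linarith
    have h5 := (abs_le.mp (abs_real_inner_le_norm v y)).1
    linarith
  refine ⟨c + ∑ j, γ j • q j, fun y hy => ?_⟩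
  suffices h : ∃ t : ℝ, ∀ i, 0 ≤ (γ i + 2 * ⟪q i, y⟫_ℝ) + t * ⟪q i, u⟫_ℝ by
    obtain ⟨t, ht⟩ := h
    refine ⟨t / 2, (F.mem_iff _).mpr fun i => ?_⟩
    have e : c + ∑ j, γ j • q j + y + (t / 2) • u - c
        = ∑ j, γ j • q j + (y + (t / 2) • u) := by abel
    rw [e, inner_add_right, inner_add_right, inner_smul_right]
    have := ht i
    have := hz i
    linarith
  refine exists_forall_add_mul_nonneg _ _ hpos ?_ ?_
  · intro i hi
    have hai : a i = 0 := by simp [ha, hi]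
    have hγi : γ i = (2 * n + 1) / (2 * n + 2) / n := by rw [hγ]; simp only [hai]; ring
    refine hcs _ _ _ (by rw [hγi]; positivity) hy ?_
    -- A facet parallel to `u` is the case a = 1, b = 0 of the margin.
    have := shadow_margin hn' zero_le_one le_rfl (le_refl (0 : ℝ)) zero_le_one
    rw [F.inner_eq, if_pos rfl, hγi, mul_div_cancel₀ _ (by positivity : (n : ℝ) ≠ 0)]
    refine le_trans (le_of_eq ?_) (this.trans (le_of_eq ?_))
    · field_simp; ring
    · ring
  · intro i j hi hj
    have hij : i ≠ j := by rintro rfl; linarith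
    have hmi : ⟪q i, u⟫_ℝ = m / 2 * a i := by
      simp only [ha]; rw [abs_of_pos hi]; field_simp
    have hmj : -⟪q j, u⟫_ℝ = m / 2 * a j := by
      simp only [ha]; rw [abs_of_neg hj]; field_simp
    have hg : γ i * a j + γ j * a i
        = ((2 * n + 1) / (2 * n + 2) * (a i + a j) - a i * a j / 2) / n := by
      simp only [hγ]; ring
    -- Up to the factor `m / 2`, this is the combination of constraints `i` and `j` that eliminates
    -- `t`.
    have key : 0 ≤ (γ i * a j + γ j * a i) + 2 * ⟪a j • q i + a i • q j, y⟫_ℝ := by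
      refine hcs _ _ _ ?_ hy ?_
      · have h1 : (3 / 4 : ℝ) ≤ (2 * n + 1) / (2 * n + 2) := by
          rw [le_div_iff₀ (by positivity)]; linarith
        have hγ0 : ∀ k, 0 ≤ γ k := fun k => div_nonneg (by linarith [ha1 k]) (by positivity)
        exact add_nonneg (mul_nonneg (hγ0 _) (ha0 _)) (mul_nonneg (hγ0 _) (ha0 _))
      · have := shadow_margin hn' (ha0 i) (ha1 i) (ha0 j) (ha1 j)
        rw [hg, mul_div_cancel₀ _ (by positivity : (n : ℝ) ≠ 0)]
        refine le_trans (le_of_eq ?_) this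
        simp only [inner_add_left, inner_add_right, real_inner_smul_left, inner_smul_right,
          F.inner_eq, if_true, if_neg hij, if_neg hij.symm]
        field_simp
        ring
    rw [inner_add_left, real_inner_smul_left, real_inner_smul_left] at key
    rw [hmi, hmj]
    have : 0 ≤ m / 2 * ((γ i * a j + γ j * a i) + 2 * (a j * ⟪q i, y⟫_ℝ + a i * ⟪q j, y⟫_ℝ)) :=
      mul_nonneg (by positivity) key
    linarith

theorem exists_shadow_translate_subset {n : ℕ} (hn : 1 ≤ n) {Δ : Set (EuclideanSpace ℝ (Fin n))}
    (h : IsUnitRegularSimplex Δ) {ε : ℝ} (hε : 0 ≤ ε) (hε' : ε ≤ 1)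
    {u : EuclideanSpace ℝ (Fin n)} (hu : ‖u‖ = 1) :
    ∃ v ∈ (Submodule.span ℝ {u})ᗮ,
      (fun x => x + v) '' shadow (kEps Δ ε) u ⊆ shadow Δ u := by
  obtain ⟨c, q, F⟩ := h.exists_frame
  obtain ⟨z, hz⟩ := F.exists_center hn (u := u) (by rintro rfl; simp at hu)
  set π := (Submodule.span ℝ {u})ᗮ.starProjection with hπ
  have hπu : π u = 0 := by
    rw [hπ, Submodule.starProjection_apply_eq_zero_iff]
    simp
  refine ⟨π ((1 - ε) • z), Submodule.starProjection_apply_mem _ _, ?_⟩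
  rintro _ ⟨_, ⟨_, ⟨_, ⟨x, hx, rfl⟩, _, ⟨y, hy, rfl⟩, rfl⟩, rfl⟩, rfl⟩
  obtain ⟨t, ht⟩ := hz ((1 / (n * √2)) • y) (by
    rw [norm_smul, Real.norm_of_nonneg (by positivity)]
    exact mul_le_of_le_one_right (by positivity) (by simpa using hy))
  refine ⟨_, h.convex hx ht hε (sub_nonneg.mpr hε') (add_sub_cancel _ _), ?_⟩
  simp only [map_add, map_smul, hπu, smul_zero, add_zero, smul_add, smul_smul, ← hπ]
  rw [mul_one_div]
  abel

/-! ### Volume -/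

section Volume

open MeasureTheory

variable {F : Type*} [NormedAddCommGroup F] [InnerProductSpace ℝ F] [FiniteDimensional ℝ F]
  [MeasurableSpace F] [BorelSpace F]

/-- A polytope whose facets are all at distance `r` from `c`, enlarged by `η r`, gains at least
the volume of its shell of relative thickness `η`. -/
theorem two_sub_mul_measure_le_measure_add_ball (μ : Measure F) [μ.IsAddHaarMeasure]
    {ι : Type*} [Fintype ι] [Nonempty ι] (w : ι → F)
    (hw : Function.Injective w) {r : ℝ} (hr : ∀ i, ‖w i‖ = r) (c : F) {P : Set F}
    (hP : ∀ x, x ∈ P ↔ ∀ i, ⟪w i, x - c⟫_ℝ ≤ r ^ 2) (hfin : μ P ≠ ⊤)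
    {η : ℝ} (hη : 0 < η) (hη' : η < 1) :
    ENNReal.ofReal (2 - (1 - η) ^ Module.finrank ℝ F) * μ P ≤
      μ (P + (η * r) • Metric.closedBall (0 : F) 1) := by
  have hw2 : ∀ i, ⟪w i, w i⟫_ℝ = r ^ 2 := fun i => by rw [real_inner_self_eq_norm_sq, hr]
  have hr0 : 0 ≤ r := by obtain ⟨i⟩ := ‹Nonempty ι›; rw [← hr i]; exact norm_nonneg _
  have hcl : IsClosed P := by
    have : P = ⋂ i, {x | ⟪w i, x - c⟫_ℝ ≤ r ^ 2} := by ext x; simp [hP]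
    rw [this]
    exact isClosed_iInter fun i => isClosed_le (by fun_prop) continuous_const
  -- The shell between `P` and its homothetic copy `H`, cut into pieces by the nearest facet. Piece
  -- `i` is pushed outwards by `η • w i`.
  set A : ι → Set F := fun i =>
    P ∩ ({x | (1 - η) * r ^ 2 < ⟪w i, x - c⟫_ℝ} ∩ ⋂ j, {x | ⟪w j, x - c⟫_ℝ ≤ ⟪w i, x - c⟫_ℝ})
    with hA
  have hAmeas : ∀ i, MeasurableSet (A i) := fun i =>
    hcl.measurableSet.inter (((isOpen_lt continuous_const (by fun_prop)).measurableSet).inter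
      (isClosed_iInter fun j => isClosed_le (by fun_prop) (by fun_prop)).measurableSet)
  set H : Set F := AffineMap.homothety c (1 - η) '' P with hH
  have hcover : P ⊆ H ∪ ⋃ i, A i := by
    intro x hx
    obtain ⟨i, hi⟩ := Finite.exists_max fun i => ⟪w i, x - c⟫_ℝ
    by_cases h : (1 - η) * r ^ 2 < ⟪w i, x - c⟫_ℝ
    · exact Or.inr (Set.mem_iUnion.mpr ⟨i, hx, h, Set.mem_iInter.mpr hi⟩)
    · refine Or.inl ⟨c + (1 - η)⁻¹ • (x - c), (hP _).mpr fun j => ?_, ?_⟩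
      · rw [add_sub_cancel_left, inner_smul_right, inv_mul_le_iff₀ (by linarith)]
        exact (hi j).trans (not_lt.mp h)
      · rw [AffineMap.homothety_apply, vsub_eq_sub, add_sub_cancel_left, smul_smul,
          mul_inv_cancel₀ (by linarith), one_smul, vadd_eq_add, sub_add_cancel]
  set T : ι → Set F := fun i => (fun x => η • w i + x) '' A i with hT
  have hTmeas : ∀ i, MeasurableSet (T i) := fun i =>
    (Homeomorph.addLeft (η • w i)).measurableEmbedding.measurableSet_image.mpr (hAmeas i)
  have hTvol : ∀ i, μ (T i) = μ (A i) := fun i => by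
    rw [hT]; simp only [Set.image_add_left]; exact measure_preimage_add _ _ _
  -- For a common point, `w j - w i` pairs nonpositively with `x - c` and nonnegatively with `y -
  -- c`, although `x - y = η • (w j - w i)`.
  have hTdisj : Pairwise (Function.onFun Disjoint T) := by
    intro i j hij
    refine Set.disjoint_left.mpr ?_
    rintro _ ⟨x, ⟨-, -, hx⟩, rfl⟩ ⟨y, ⟨-, -, hy⟩, hxy⟩
    have h1 : ⟪w j, x - c⟫_ℝ ≤ ⟪w i, x - c⟫_ℝ := Set.mem_iInter.mp hx j
    have h2 : ⟪w i, y - c⟫_ℝ ≤ ⟪w j, y - c⟫_ℝ := Set.mem_iInter.mp hy i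
    have h3 : x - c = (y - c) + η • (w j - w i) := by
      have : η • w j + y = η • w i + x := hxy
      rw [smul_sub, ← sub_eq_zero]
      rw [← sub_eq_zero] at this
      rw [← neg_eq_zero, ← this]; abel
    rw [h3, inner_add_right, inner_add_right] at h1
    have h4 : η * ⟪w j - w i, w j - w i⟫_ℝ ≤ 0 := by
      rw [← inner_smul_right, inner_sub_left]; linarith
    have h5 : ⟪w j - w i, w j - w i⟫_ℝ ≤ 0 := nonpos_of_mul_nonpos_right h4 hη
    rw [real_inner_self_nonpos, sub_eq_zero] at h5
    exact hij (hw h5.symm)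
  -- The push raises the pairing with `w i` by η r², from above (1-η) r² to above r².
  have hPT : Disjoint P (⋃ i, T i) := by
    refine Set.disjoint_left.mpr fun y hy hyT => ?_
    obtain ⟨i, x, ⟨-, hx, -⟩, rfl⟩ := Set.mem_iUnion.mp hyT
    have h1 := (hP _).mp hy i
    have hx : (1 - η) * r ^ 2 < ⟪w i, x - c⟫_ℝ := hx
    simp only at h1
    rw [add_sub_assoc, inner_add_right, inner_smul_right, hw2] at h1
    linarith
  have hsub : P ∪ ⋃ i, T i ⊆ P + (η * r) • Metric.closedBall (0 : F) 1 := by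
    rw [smul_unitClosedBall_of_nonneg (by positivity)]
    refine Set.union_subset (fun x hx => ⟨x, hx, 0, ?_, add_zero x⟩) (Set.iUnion_subset fun i => ?_)
    · simpa using by positivity
    · rintro _ ⟨x, hx, rfl⟩
      refine ⟨x, hx.1, η • w i, ?_, add_comm _ _⟩
      rw [mem_closedBall_zero_iff, norm_smul, hr, Real.norm_of_nonneg hη.le]
  have hHvol : μ H = ENNReal.ofReal ((1 - η) ^ Module.finrank ℝ F) * μ P := by
    rw [hH, Measure.addHaar_image_homothety, abs_of_nonneg (pow_nonneg (by linarith) _)]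
  have hle1 : (1 - η) ^ Module.finrank ℝ F ≤ 1 := pow_le_one₀ (by linarith) (by linarith)
  have hshell : μ P ≤ μ H + μ (⋃ i, T i) := by
    calc μ P ≤ μ H + μ (⋃ i, A i) := (measure_mono hcover).trans (measure_union_le _ _)
      _ ≤ μ H + μ (⋃ i, T i) := by
        refine add_le_add_right ?_ _
        rw [measure_iUnion hTdisj hTmeas]
        simp only [hTvol]
        exact measure_iUnion_le _ 
  have hX : μ P + μ (⋃ i, T i) ≤ μ (P + (η * r) • Metric.closedBall (0 : F) 1) := by
    rw [← measure_union hPT (MeasurableSet.iUnion hTmeas)]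
    exact measure_mono hsub
  refine le_trans ?_ hX
  have hHfin : μ H ≠ ⊤ := by rw [hHvol]; exact ENNReal.mul_ne_top ENNReal.ofReal_ne_top hfin
  refine (ENNReal.add_le_add_iff_right hHfin).mp ?_
  calc ENNReal.ofReal (2 - (1 - η) ^ Module.finrank ℝ F) * μ P + μ H = 2 * μ P := by
        rw [hHvol, ← add_mul, ← ENNReal.ofReal_add (by linarith) (pow_nonneg (by linarith) _)]
        norm_num
    _ = μ P + μ P := two_mul _
    _ ≤ μ P + (μ H + μ (⋃ i, T i)) := by gcongr
    _ = μ P + μ (⋃ i, T i) + μ H := by rw [add_comm (μ H), add_assoc]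

end Volume

/-- At ε = 1 the expression equals 1 with derivative n(1-κ) < 0, so it exceeds 1 just to the left.
The other inequality holds once ε > κ/(1+κ). -/
theorem exists_lt_two_mul_pow_sub_pow {n : ℕ} (hn : 1 ≤ n) {κ : ℝ} (hκ : 1 < κ) :
    ∃ ε₀ : ℝ, 0 ≤ ε₀ ∧ ε₀ < 1 ∧ ∀ ε, ε₀ < ε → ε < 1 →
      κ * (1 - ε) < ε ∧ 1 < 2 * ε ^ n - (ε - κ * (1 - ε)) ^ n := by
  have hd : HasDerivAt (fun ε : ℝ => 2 * ε ^ n - (ε - κ * (1 - ε)) ^ n) (n * (1 - κ)) 1 := by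
    have h1 := (hasDerivAt_pow n (1 : ℝ)).const_mul 2
    have h2 := ((hasDerivAt_id (1 : ℝ)).sub
      (((hasDerivAt_id (1 : ℝ)).const_sub 1).const_mul κ)).pow n
    refine (h1.sub h2).congr_deriv ?_
    simp
    ring
  have hneg : (n : ℝ) * (1 - κ) < 0 :=
    mul_neg_of_pos_of_neg (by exact_mod_cast hn) (by linarith)
  have hev : ∀ᶠ ε in nhdsWithin (1 : ℝ) (Set.Iio 1),
      1 < 2 * ε ^ n - (ε - κ * (1 - ε)) ^ n := by
    have h1 := (hasDerivAt_iff_tendsto_slope_left_right.mp hd).1.eventually (gt_mem_nhds hneg)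
    filter_upwards [h1, self_mem_nhdsWithin] with ε h2 h3
    have h3 : ε < 1 := h3
    rw [slope_def_field] at h2
    have h4 := (div_neg_iff.mp h2).resolve_right (fun h => by linarith [h.2])
    have h5 := h4.1
    simp at h5
    linarith
  obtain ⟨l, hl, hl'⟩ := (mem_nhdsLT_iff_exists_Ioo_subset).mp hev
  have hl : l < 1 := hl
  have hk : κ / (1 + κ) < 1 := by rw [div_lt_one (by linarith)]; linarith
  refine ⟨max l (κ / (1 + κ)), le_max_of_le_right (by positivity), max_lt hl hk,
    fun ε h1 h2 => ⟨?_, hl' ⟨(le_max_left _ _).trans_lt h1, h2⟩⟩⟩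
  have := (le_max_right _ _).trans_lt h1
  rw [div_lt_iff₀ (by linarith)] at this
  linarith

theorem volume_lt_volume_kEps {n : ℕ} (hn : 1 ≤ n) {Δ : Set (EuclideanSpace ℝ (Fin n))}
    (h : IsUnitRegularSimplex Δ) {ε : ℝ} (hε : 0 < ε) (hε' : ε < 1)
    (h1 : √(((n : ℝ) + 1) / n) * (1 - ε) < ε)
    (h2 : 1 < 2 * ε ^ n - (ε - √(((n : ℝ) + 1) / n) * (1 - ε)) ^ n) :
    MeasureTheory.volume Δ < MeasureTheory.volume (kEps Δ ε) := by
  obtain ⟨c, q, F⟩ := h.exists_frame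
  have hn0 : (0 : ℝ) < n := by exact_mod_cast hn
  set κ := √(((n : ℝ) + 1) / n) with hκ
  have hκ0 : 0 < κ := Real.sqrt_pos.mpr (by positivity)
  set r := √(1 / (2 * n * ((n : ℝ) + 1))) with hr
  have hr2 : r ^ 2 = 1 / (2 * n * ((n : ℝ) + 1)) := Real.sq_sqrt (by positivity)
  have hr0 : 0 ≤ r := Real.sqrt_nonneg _
  have hκr : κ * r = 1 / (n * √2) := by
    rw [hκ, hr, ← Real.sqrt_mul (by positivity)]
    have : ((n : ℝ) + 1) / n * (1 / (2 * n * ((n : ℝ) + 1))) = (1 / (n * √2)) ^ 2 := by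
      rw [div_pow, mul_pow, Real.sq_sqrt (by norm_num)]; field_simp
    rw [this, Real.sqrt_sq (by positivity)]
  have hself : ∀ i, ⟪q i, q i⟫_ℝ = n ^ 2 * r ^ 2 := fun i => by
    rw [F.inner_eq, if_pos rfl, hr2]; field_simp; ring
  -- From the centroid, `-(1/n) • q i` leads to the centre of the facet opposite vertex `i`.
  have hinj : Function.Injective fun i => (-(1 / n) : ℝ) • q i := by
    intro i j hij
    have hq : q i = q j := smul_right_injective _ (by simp; omega) hij
    by_contra hne
    have e1 := F.inner_eq i j
    rw [← hq, F.inner_eq i i, if_pos rfl, if_neg hne] at e1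
    linarith
  have hnorm : ∀ i, ‖(-(1 / n) : ℝ) • q i‖ = r := by
    intro i
    rw [← sq_eq_sq₀ (norm_nonneg _) hr0, ← real_inner_self_eq_norm_sq,
      real_inner_smul_left, inner_smul_right, hself]
    field_simp
  -- Chosen so that ε η r = (1-ε)/(n√2), which makes K^ε the ε-dilate of Δ enlarged by η r.
  set η := κ * (1 - ε) / ε with hη
  have hη0 : 0 < η := div_pos (mul_pos hκ0 (by linarith)) hε
  have hη1 : η < 1 := by rw [hη, div_lt_one hε]; exact h1
  have key := two_sub_mul_measure_le_measure_add_ball MeasureTheory.volume _ hinj hnorm c (P := Δ)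
    (fun x => by
      rw [F.mem_iff]
      refine forall_congr' fun i => ?_
      rw [real_inner_smul_left, hr2, neg_mul, neg_le]
      have e : 1 / ((n : ℝ) + 1) + 2 * ⟪q i, x - c⟫_ℝ =
        2 * n * (1 / n * ⟪q i, x - c⟫_ℝ - -(1 / (2 * n * ((n : ℝ) + 1)))) := by field_simp; ring
      rw [e]
      have hpos : 0 < 2 * (n : ℝ) := by positivity
      exact (mul_nonneg_iff_of_pos_left hpos).trans sub_nonneg)
    h.isCompact.measure_lt_top.ne hη0 hη1
  have hK : kEps Δ ε = ε • (Δ + (η * r) • Metric.closedBall (0 : EuclideanSpace ℝ (Fin n)) 1) := by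
    rw [kEps, smul_add, smul_smul]
    congr 2
    have : ε * (η * r) = (1 - ε) * (κ * r) := by rw [hη]; field_simp
    rw [this, hκr, mul_one_div]
  rw [hK, MeasureTheory.Measure.addHaar_smul_of_nonneg _ hε.le]
  rw [finrank_euclideanSpace_fin] at key ⊢
  refine lt_of_lt_of_le ?_ (mul_le_mul_right key _)
  rw [← mul_assoc, ← ENNReal.ofReal_mul (by positivity)]
  have e : ε ^ n * (2 - (1 - η) ^ n) = 2 * ε ^ n - (ε - κ * (1 - ε)) ^ n := by
    rw [mul_sub, ← mul_pow, mul_sub, hη, mul_one, mul_div_cancel₀ _ hε.ne']; ring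
  rw [e]
  nth_rewrite 1 [← one_mul (MeasureTheory.volume Δ)]
  have hpos := h.volume_pos
  have hfin : MeasureTheory.volume Δ < ⊤ := h.isCompact.measure_lt_top
  exact ENNReal.mul_lt_mul_left hpos.ne' hfin.ne (ENNReal.one_lt_ofReal.mpr h2)

end CoveringShadows

theorem mainTheorem5 (n : ℕ) (hn : 1 ≤ n) :
    (∀ Δ : Set (EuclideanSpace ℝ (Fin n)), CoveringShadows.IsUnitRegularSimplex Δ →
      ∀ ε : ℝ, 0 ≤ ε → ε ≤ 1 →
        ∀ u : EuclideanSpace ℝ (Fin n), ‖u‖ = 1 →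
          ∃ v ∈ (Submodule.span ℝ {u})ᗮ,
            (fun x => x + v) '' CoveringShadows.shadow (CoveringShadows.kEps Δ ε) u ⊆
              CoveringShadows.shadow Δ u) ∧
    (∃ ε₀ : ℝ, 0 ≤ ε₀ ∧ ε₀ < 1 ∧
      ∀ ε : ℝ, ε₀ < ε → ε < 1 →
        ∀ Δ : Set (EuclideanSpace ℝ (Fin n)), CoveringShadows.IsUnitRegularSimplex Δ →
          MeasureTheory.volume Δ <
            MeasureTheory.volume (CoveringShadows.kEps Δ ε)) := by
  refine ⟨fun Δ hΔ ε h0 h1 u hu =>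
    CoveringShadows.exists_shadow_translate_subset hn hΔ h0 h1 hu, ?_⟩
  have hn0 : (0 : ℝ) < n := by exact_mod_cast hn
  have hκ : 1 < √(((n : ℝ) + 1) / n) := by
    rw [Real.lt_sqrt (by norm_num), one_pow, lt_div_iff₀ hn0]; linarith
  obtain ⟨ε₀, h0, h1, h⟩ := CoveringShadows.exists_lt_two_mul_pow_sub_pow hn hκ
  exact ⟨ε₀, h0, h1, fun ε hε hε' Δ hΔ => CoveringShadows.volume_lt_volume_kEps hn hΔ
    (h0.trans_lt hε) hε' (h ε hε hε').1 (h ε hε hε').2⟩
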